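/- Setting. All vectors are binary and $\oplus$ is addition mod 2. Let $p_1,\alpha\in[0,\tfrac12)$, $p=p_1(1-\alpha)+(1-p_1)\alpha$, and let $p<\tau<\tfrac12$. The ground truth $\mathbf A_0\in\{0,1\}^n$ is i.i.d. Bernoulli$(\tfrac12)$; the enrollment and probe vectors are $\mathbf A=\mathbf A_0\oplus\mathbf N_1$ and $\mathbf B=\mathbf A_0\oplus\mathbf N_2$, where $\mathbf N_1,\mathbf N_2$ are i.i.d. Bernoulli$(p_1)$ and Bernoulli$(\alpha)$ vectors, and $\mathbf A_0,\mathbf N_1,\mathbf N_2$ are independent. Fix a binary $[n,k]$ linear code with full-rank $k\times n$ generator matrix $\mathbf G$ and full-rank $m\times n$ parity check matrix $\mathbf H$, $\mathbf H\mathbf G^{\mathrm T}=0$, $m=n-k$, $R=k/n$. For a syndrome $\mathbf q$ let $\hat{\mathbf W}(\mathbf q)$ be a vector of least Hamming weight $d(\cdot)$ among those $\mathbf W$ with $\mathbf H\mathbf W=\mathbf q$ (ties broken by any fixed rule). Four systems $(\mathbf S,\mathbf K)=F(\mathbf A)$, $\hat\theta=g(\mathbf D,\mathbf L,\mathbf S)$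 are considered; in each, $g=1$ if $d(\hat{\mathbf W}(\mathbf q))\le\tau n$ and $g=0$ otherwise. Two-factor fuzzy commitment: $\mathbf S=\mathbf A\oplus\mathbf G^{\mathrm T}\mathbf Z\oplus\mathbf K$ with $\mathbf Z\in\{0,1\}^k$, $\mathbf K\in\{0,1\}^n$ uniform, $\mathbf q=\mathbf H(\mathbf D\oplus\mathbf L\oplus\mathbf S)$. Two-factor secure sketch: $\mathbf S=\mathbf H\mathbf A\oplus\mathbf K$ with $\mathbf K\in\{0,1\}^m$ uniform, $\mathbf q=\mathbf H\mathbf D\oplus\mathbf L\oplus\mathbf S$. Here $\mathbf K,\mathbf Z$ are independent of each other and of $(\mathbf A_0,\mathbf N_1,\mathbf N_2)$. The keyless variants are obtained by removing $\mathbf K$ and $\mathbf L$. Metrics. $P_{FR}=\Pr[g(\mathbf B,\mathbf K,\mathbf S)=0]$; $P_{FA}$ is the maximum of $\Pr[g(\mathbf C,\mathbf J,\mathbf S)=1]$ over all laws of $(\mathbf C,\mathbf J)$ independent of everything else; for $\mathcal V\subseteq\{\mathbf A,\mathbf S,\mathbf K\}$, $P_{SA}(\mathcal V)$ is the maximum of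 the same probability over all conditional laws of $(\mathbf C,\mathbf J)$ given $\mathcal V$ (in keyless systems $\mathbf K$ and $\mathbf J$ are absent). Further, $h_b(q)=-q\log_2q-(1-q)\log_2(1-q)$, $D(q\|p)=q\log_2\frac qp+(1-q)\log_2\frac{1-q}{1-p}$ (with the usual conventions; $+\infty$ if $p=0<q$), and $E(R)=\min_{0\le q\le1}\bigl(D(q\|p)+\max\{1-h_b(q)-R,0\}\bigr)$. Let $P_e$ be the probability that the decoder, applied to a uniform codeword sent over a binary symmetric channel with crossover probability $p$, does not return that codeword. Theorem. For every such code, the four systems have the same $P_{FR}$ and the same $P_{FA}$, and: (i) for codes with $P_e\le2^{-nE(R)+o(n)}$ as $n\to\infty$, $P_{FR}\le2^{-nD(\tau\|p)}+2^{-nE(R)+o(n)}$ (with the same $o(n)$ term); such codes exist for all $n$ and all $0\le k\le n$, with an $o(n)$ term that depends on $n$ and $p$ only, whatever the rule for ties; (ii) $P_{FA}\le2^{-n\left(\frac mn-h_b(\tau)\right)}$. For both two-factor systems: (iii) $P_{SA}(\mathbf K)=P_{FA}$; (iv) $P_{SA}(\mathbf A)=P_{FA}$; (v) $P_{SA}(\mathbf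 S)=P_{SA}(\mathbf A,\mathbf K)=P_{SA}(\mathbf A,\mathbf S)=P_{SA}(\mathbf S,\mathbf K)=P_{SA}(\mathbf A,\mathbf S,\mathbf K)=1$. For both keyless systems: (vi) $P_{SA}(\mathbf S)=P_{SA}(\mathbf A)=P_{SA}(\mathbf A,\mathbf S)=1$. -/

import Mathlib

open scoped ENNReal unitInterval

noncomputable section

namespace SecureBiometrics

/-! ### Binary vectors and their laws -/

/-- Binary vectors of length `n`; componentwise modulo-two addition is `+`. -/
abbrev Bits (n : ℕ) : Type := Fin n → ZMod 2

/-- The Bernoulli(`q`) law of one bit. -/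
def bernoulliBit (q : I) : PMF (ZMod 2) :=
  PMF.ofFintype (fun b => if b = 1 then ENNReal.ofReal q else ENNReal.ofReal (1 - q)) (by
    rw [show (Finset.univ : Finset (ZMod 2)) = {0, 1} from rfl, Finset.sum_pair (by decide),
      if_neg (by decide), if_pos rfl, ← ENNReal.ofReal_add (sub_nonneg.2 q.2.2) q.2.1]
    simp)

/-- The law of `n` i.i.d. Bernoulli(`q`) bits. -/
def bernoulliVec (q : I) (n : ℕ) : PMF (Bits n) :=
  PMF.ofFintype (fun x => ∏ i, bernoulliBit q (x i)) (by
    have h := Finset.prod_univ_sum (fun _ : Fin n => (Finset.univ : Finset (ZMod 2)))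
      (fun _ b => bernoulliBit q b)
    rw [Fintype.piFinset_univ] at h
    rw [← h]
    have h1 : ∑ b : ZMod 2, bernoulliBit q b = 1 := by
      rw [← tsum_fintype (L := SummationFilter.unconditional _)]
      exact (bernoulliBit q).tsum_coe
    simp [h1])

/-- The law of `n` i.i.d. Bernoulli(1/2) bits. -/
def fairVec (n : ℕ) : PMF (Bits n) :=
  bernoulliVec ⟨1 / 2, by norm_num, by norm_num⟩ n

/-- Crossover probability `p₁ * α = p₁ (1 - α) + (1 - p₁) α` of the concatenation of two binary
symmetric channels. -/
def bscComp (p₁ α : I) : I :=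
  ⟨p₁ * (1 - α) + (1 - p₁) * α, by
    have h1 := p₁.2.1; have h2 := p₁.2.2; have h3 := α.2.1; have h4 := α.2.2
    constructor
    · exact add_nonneg (mul_nonneg h1 (sub_nonneg.2 h4)) (mul_nonneg (sub_nonneg.2 h2) h3)
    · nlinarith [mul_nonneg h1 h3, mul_nonneg (sub_nonneg.2 h2) (sub_nonneg.2 h4)]⟩

/-! ### Secure biometric systems and their performance metrics -/

/-- A secure biometric system with feature vectors in `{0,1}ⁿ`, stored data in `S` and keys in `K`:
a randomized encoding `A ↦ (S, K)` and a decision function `(D, L, S) ↦ θ̂`. In a keyless system the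
key is null, `K = Unit`. -/
structure System (n : ℕ) (S K : Type) where
  enroll : Bits n → PMF (S × K)
  verify : Bits n → K → S → Bool

/-- The data that may be exposed: enrollment biometric, stored data, key. -/
inductive Datum
  | bio
  | stored
  | key

namespace System

variable {n : ℕ} {S K : Type}

/-- Joint law of `(A, B, S, K)`. The ground truth `A₀` is uniform, `A = A₀ + N₁` and `B = A₀ + N₂`
with independent noises of parameters `p₁` and `α`, and `(S, K)` is the encoding of `A`. -/
def law (sys : System n S K) (p₁ α : I) : PMF (Bits n × Bits n × S × K) :=
  (fairVec n).bind fun A₀ =>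
  (bernoulliVec p₁ n).bind fun N₁ =>
  (bernoulliVec α n).bind fun N₂ =>
  (sys.enroll (A₀ + N₁)).bind fun SK =>
  PMF.pure (A₀ + N₁, A₀ + N₂, SK.1, SK.2)

/-- False rejection rate: the probability that `g(B, K, S) = 0`. -/
def PFR (sys : System n S K) (p₁ α : I) : ℝ≥0∞ :=
  ((sys.law p₁ α).map fun (_, B, s, k) => sys.verify B k s) false

/-- False acceptance rate: the largest probability that `g(C, J, S) = 1`, over all laws of `(C, J)`,
where `(C, J)` is independent of all the other variables. -/
def PFA (sys : System n S K) (p₁ α : I) : ℝ≥0∞ :=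
  ⨆ adv : PMF (Bits n × K),
    ((sys.law p₁ α).bind fun (_, _, s, _) => adv.map fun (C, J) => sys.verify C J s) true

open Classical in
/-- What an adversary sees of `(A, S, K)` when exactly the data in `V` are exposed. -/
def view (V : Set Datum) (A : Bits n) (s : S) (k : K) : Option (Bits n) × Option S × Option K :=
  (if Datum.bio ∈ V then some A else none,
   if Datum.stored ∈ V then some s else none,
   if Datum.key ∈ V then some k else none)

/-- Successful attack rate: the largest probability that `g(C, J, S) = 1`, over all conditional laws
of `(C, J)` given the exposed data `V`. -/
def PSA (sys : System n S K) (p₁ α : I) (V : Set Datum) : ℝ≥0∞ :=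
  ⨆ adv : Option (Bits n) × Option S × Option K → PMF (Bits n × K),
    ((sys.law p₁ α).bind fun (A, _, s, k) =>
      (adv (view V A s k)).map fun (C, J) => sys.verify C J s) true

end System

/-! ### Linear codes -/

/-- A binary `[n, k]` linear code, given by a generator matrix `G` and a parity check matrix `H`, both
of full row rank, with `m = n - k` parity checks. -/
structure LinCode (n k m : ℕ) where
  G : Matrix (Fin k) (Fin n) (ZMod 2)
  H : Matrix (Fin m) (Fin n) (ZMod 2)
  dim : k + m = n
  G_rank : LinearIndependent (ZMod 2) G.row
  H_rank : LinearIndependent (ZMod 2) H.row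
  ortho : H * G.transpose = 0

namespace LinCode

variable {n k m : ℕ}

/-- `dec` is a syndrome decoder: `dec s` is a vector of least Hamming weight among the `W` with
`H W = s`. Ties are broken in an arbitrary way. -/
def IsDecoder (c : LinCode n k m) (dec : Bits m → Bits n) : Prop :=
  ∀ s, c.H.mulVec (dec s) = s ∧
    ∀ W, c.H.mulVec W = s → hammingNorm (dec s) ≤ hammingNorm W

/-- Probability of decoding error on the binary symmetric channel with crossover probability `p`: a
uniform codeword `X = Gᵀ Z` is sent, `Y = X + N` is received and decoded to `Y + dec (H Y)`. -/
def errorProb (c : LinCode n k m) (dec : Bits m → Bits n) (p : I) : ℝ≥0∞ :=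
  ((fairVec k).bind fun Z =>
    (bernoulliVec p n).map fun N =>
      let X := c.G.transpose.mulVec Z
      let Y := X + N
      decide (Y + dec (c.H.mulVec Y) ≠ X)) true

open Classical in
/-- The threshold test: access is granted iff the weight of the estimate `W` is at most `τ n`. -/
def threshold (τ : ℝ) (W : Bits n) : Bool :=
  decide ((hammingNorm W : ℝ) ≤ τ * n)

/-- Two-factor fuzzy commitment: `S = A + Gᵀ Z + K`. -/
def fuzzyKeyed (c : LinCode n k m) (dec : Bits m → Bits n) (τ : ℝ) : System n (Bits n) (Bits n) where
  enroll A := (fairVec n).bind fun K => (fairVec k).map fun Z =>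
    (A + c.G.transpose.mulVec Z + K, K)
  verify D L S := threshold τ (dec (c.H.mulVec (D + L + S)))

/-- Keyless fuzzy commitment: `S = A + Gᵀ Z`. -/
def fuzzyKeyless (c : LinCode n k m) (dec : Bits m → Bits n) (τ : ℝ) : System n (Bits n) Unit where
  enroll A := (fairVec k).map fun Z => (A + c.G.transpose.mulVec Z, ())
  verify D _ S := threshold τ (dec (c.H.mulVec (D + S)))

/-- Two-factor secure sketch: `S = H A + K`. -/
def sketchKeyed (c : LinCode n k m) (dec : Bits m → Bits n) (τ : ℝ) : System n (Bits m) (Bits m) where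
  enroll A := (fairVec m).map fun K => (c.H.mulVec A + K, K)
  verify D L S := threshold τ (dec (c.H.mulVec D + L + S))

/-- Keyless secure sketch: `S = H A`. -/
def sketchKeyless (c : LinCode n k m) (dec : Bits m → Bits n) (τ : ℝ) : System n (Bits m) Unit where
  enroll A := PMF.pure (c.H.mulVec A, ())
  verify D _ S := threshold τ (dec (c.H.mulVec D + S))

end LinCode

/-! ### Exponents, in bits -/

/-- The binary entropy function `h_b(q) = - q log₂ q - (1 - q) log₂ (1 - q)`. -/
def hb (q : ℝ) : ℝ := Real.binEntropy q / Real.log 2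

open Classical in
/-- The divergence `D(q‖p)` between Bernoulli(`q`) and Bernoulli(`p`) in bits; it is `+∞` when the
first law is not absolutely continuous with respect to the second. -/
def klBits (q p : ℝ) : EReal :=
  if (p = 0 ∧ q ≠ 0) ∨ (p = 1 ∧ q ≠ 1) then ⊤
  else ((q * Real.logb 2 (q / p) + (1 - q) * Real.logb 2 ((1 - q) / (1 - p)) : ℝ) : EReal)

/-- The error exponent `E(R) = min_q (D(q‖p) + max {1 - h_b(q) - R, 0})`. -/
def errorExponent (p R : ℝ) : EReal :=
  ⨅ q ∈ Set.Icc (0 : ℝ) 1, klBits q p + ((max (1 - hb q - R) 0 : ℝ) : EReal)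

/-- `2 ^ x` for an extended real exponent, with `2 ^ (-∞) = 0`. -/
def two_pow (x : EReal) : ℝ≥0∞ := EReal.exp (x * (Real.log 2 : ℝ))

end SecureBiometrics

end

/-!
All four systems accept exactly when a syndrome of the form `H (D + A) + (key mask)` is accepted by
the decoder, so their metrics reduce to two quantities. For the legitimate user the mask cancels and
the syndrome is that of the noise `N = A + B`, a Bernoulli(`p₁ * α`) vector; the decoder outputs a
vector at most as heavy as `N`, so a rejection forces `N` into the upper tail above `τ n`. For an
adversary who cannot cancel the mask the syndrome is uniform, whatever the attack, and the accepted
syndromes inject into the Hamming ball of radius `τ n`. An adversary who sees the stored data, or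
all the inputs that determine their syndrome, forces the syndrome `0`, which is always accepted.

Tail and ball estimates come from a single change of measure, from Bernoulli(`p`) to Bernoulli(`q`).
Good codes are found among systematic codes with a uniform parity block: such a code contains a
given nonzero vector with probability at most `2⁻ᵐ`, so the union bound over the vectors that are at
most as heavy as the noise, summed over the weight of the noise, gives the exponent `E(R)` up to
the factor `n + 1`.
-/

namespace SecureBiometrics

section PMF

variable {α β : Type*}

theorem map_apply_eq_toOuterMeasure (μ : PMF α) (f : α → β) (b : β) :
    μ.map f b = μ.toOuterMeasure {a | f a = b} := by
  rw [← PMF.toOuterMeasure_apply_singleton, PMF.toOuterMeasure_map_apply]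
  rfl

theorem bind_congr_of_mem_support {μ : PMF α} {f g : α → PMF β}
    (h : ∀ a ∈ μ.support, f a = g a) : μ.bind f = μ.bind g := by
  ext b
  simp only [PMF.bind_apply]
  refine tsum_congr fun a => ?_
  by_cases ha : a ∈ μ.support
  · rw [h a ha]
  · rw [(μ.apply_eq_zero_iff a).2 ha, zero_mul, zero_mul]

theorem toOuterMeasure_le_of_apply_le_mul {μ ν : PMF α} {s : Set α} {r : ℝ≥0∞}
    (h : ∀ a ∈ s, μ a ≤ ν a * r) : μ.toOuterMeasure s ≤ r := by
  rw [PMF.toOuterMeasure_apply]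
  calc ∑' a, s.indicator μ a ≤ ∑' a, ν a * r :=
        ENNReal.tsum_le_tsum fun a => Set.indicator_apply_le' (h a) fun _ => zero_le
    _ = r := by rw [ENNReal.tsum_mul_right, ν.tsum_coe, one_mul]

theorem exists_le_tsum_mul [Finite α] (μ : PMF α) (f : α → ℝ≥0∞) :
    ∃ a, f a ≤ ∑' b, μ b * f b := by
  have : Nonempty α := ⟨μ.support_nonempty.some⟩
  obtain ⟨a, ha⟩ := Finite.exists_min f
  refine ⟨a, ?_⟩
  calc f a = ∑' b, μ b * f a := by rw [ENNReal.tsum_mul_right, μ.tsum_coe, one_mul]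
    _ ≤ ∑' b, μ b * f b := ENNReal.tsum_le_tsum fun b => mul_le_mul_right (ha b) _

theorem tsum_map_apply_mul (μ : PMF α) (f : α → β) (g : β → ℝ≥0∞) :
    ∑' b, μ.map f b * g b = ∑' a, μ a * g (f a) := by
  classical
  simp only [PMF.map_apply, ← ENNReal.tsum_mul_right]
  rw [ENNReal.tsum_comm]
  refine tsum_congr fun a => (tsum_eq_single (f a) fun b hb => ?_).trans ?_
  · rw [if_neg hb, zero_mul]
  · rw [if_pos rfl]

theorem tsum_mul_toOuterMeasure_comm (μ : PMF α) (ν : PMF β) (r : α → β → Prop) :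
    ∑' a, μ a * ν.toOuterMeasure {b | r a b} = ∑' b, ν b * μ.toOuterMeasure {a | r a b} := by
  classical
  simp only [PMF.toOuterMeasure_apply, Set.indicator_apply, Set.mem_ofPred_eq,
    ← ENNReal.tsum_mul_left, mul_ite, mul_zero]
  rw [ENNReal.tsum_comm]
  simp only [mul_comm]

theorem bind_map_add_apply {G : Type*} [AddCommGroup G] (μ ν : PMF G) (x : G) :
    (μ.bind fun a => ν.map (a + ·)) x = ∑' a, μ a * ν (x - a) := by
  simp only [PMF.bind_apply, map_apply_eq_toOuterMeasure]
  refine tsum_congr fun a => ?_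
  have hfiber : {b | a + b = x} = {x - a} := by
    ext b
    exact eq_sub_iff_add_eq'.symm
  rw [hfiber, PMF.toOuterMeasure_apply_singleton]

theorem eq_uniformOfFintype_of_forall_eq [Fintype α] [Nonempty α] {μ : PMF α}
    (h : ∀ a b, μ a = μ b) : μ = PMF.uniformOfFintype α := by
  ext a
  have hsum : Fintype.card α * μ a = 1 := by
    rw [← μ.tsum_coe, tsum_fintype, Finset.sum_congr rfl fun b _ => h b a, Finset.sum_const,
      Finset.card_univ, nsmul_eq_mul]
  rw [PMF.uniformOfFintype_apply, ENNReal.eq_inv_of_mul_eq_one_left ((mul_comm _ _).trans hsum)]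

theorem map_equiv_uniformOfFintype [Fintype α] [Nonempty α] (e : α ≃ α) :
    (PMF.uniformOfFintype α).map e = PMF.uniformOfFintype α := by
  refine eq_uniformOfFintype_of_forall_eq fun a b => ?_
  have hfiber (c : α) : {x | e x = c} = {e.symm c} := by
    ext x
    exact e.eq_symm_apply.symm
  simp only [map_apply_eq_toOuterMeasure, hfiber, PMF.toOuterMeasure_apply_singleton,
    PMF.uniformOfFintype_apply]

theorem map_uniformOfFintype_of_surjective {G H : Type*} [AddGroup G] [Fintype G] [AddGroup H]
    [Fintype H] (f : G →+ H) (hf : Function.Surjective f) :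
    (PMF.uniformOfFintype G).map f = PMF.uniformOfFintype H := by
  classical
  refine eq_uniformOfFintype_of_forall_eq fun x y => ?_
  simp only [map_apply_eq_toOuterMeasure, PMF.toOuterMeasure_uniformOfFintype_apply,
    Set.coe_ofPred, Fintype.card_subtype]
  rw [AddMonoidHom.card_fiber_eq_of_mem_range f (hf x) (hf y)]

end PMF

section Bernoulli

theorem bernoulliBit_zero (q : I) : bernoulliBit q 0 = ENNReal.ofReal (1 - q) := by
  simp [bernoulliBit]

theorem bernoulliBit_one (q : I) : bernoulliBit q 1 = ENNReal.ofReal q := by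
  simp [bernoulliBit]

theorem bernoulliVec_apply_eq_prod (q : I) (n : ℕ) (x : Bits n) :
    bernoulliVec q n x = ∏ i, bernoulliBit q (x i) :=
  PMF.ofFintype_apply _ x

theorem hammingNorm_le (n : ℕ) (x : Bits n) : hammingNorm x ≤ n := by
  simpa using hammingNorm_le_card_fintype (x := x)

theorem bernoulliVec_apply (q : I) (n : ℕ) (x : Bits n) :
    bernoulliVec q n x =
      ENNReal.ofReal (q ^ hammingNorm x * (1 - q) ^ (n - hammingNorm x)) := by
  have hbit (b : ZMod 2) :
      bernoulliBit q b = ENNReal.ofReal (if b ≠ 0 then (q : ℝ) else 1 - q) := by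
    fin_cases b
    · exact bernoulliBit_zero q
    · exact bernoulliBit_one q
  have hzeros : Finset.card {i | ¬ x i ≠ 0} = n - hammingNorm x := by
    rw [hammingNorm, Finset.filter_not, Finset.card_sdiff_of_subset (Finset.filter_subset _ _),
      Finset.card_univ, Fintype.card_fin]
  simp only [bernoulliVec_apply_eq_prod, hbit]
  rw [← ENNReal.ofReal_prod_of_nonneg fun i _ => ?_]
  · rw [Finset.prod_ite, Finset.prod_const, Finset.prod_const, hzeros, hammingNorm]
  · split_ifs
    exacts [q.2.1, sub_nonneg.2 q.2.2]

theorem fairVec_eq_uniformOfFintype (n : ℕ) : fairVec n = PMF.uniformOfFintype (Bits n) := by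
  have hfair (x : Bits n) : fairVec n x = ENNReal.ofReal ((1 / 2) ^ n) := by
    rw [fairVec, bernoulliVec_apply, sub_half, ← pow_add,
      Nat.add_sub_cancel' (hammingNorm_le n x)]
  exact eq_uniformOfFintype_of_forall_eq fun x y => (hfair x).trans (hfair y).symm

theorem fairVec_map_add_left (n : ℕ) (a : Bits n) : (fairVec n).map (a + ·) = fairVec n := by
  rw [fairVec_eq_uniformOfFintype]
  exact map_equiv_uniformOfFintype (Equiv.addLeft a)

theorem fairVec_map_mulVec {n m : ℕ} {H : Matrix (Fin m) (Fin n) (ZMod 2)}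
    (hH : Function.Surjective H.mulVec) : (fairVec n).map H.mulVec = fairVec m := by
  simp only [fairVec_eq_uniformOfFintype]
  exact map_uniformOfFintype_of_surjective H.mulVecLin.toAddMonoidHom hH

theorem map_mulVec_uniformOfFintype {k m : ℕ} {b : Bits k} (hb : b ≠ 0) :
    (PMF.uniformOfFintype (Matrix (Fin m) (Fin k) (ZMod 2))).map (fun P => P.mulVec b) =
      PMF.uniformOfFintype (Bits m) := by
  obtain ⟨j, hj⟩ := Function.ne_iff.1 hb
  refine map_uniformOfFintype_of_surjective
    ((Matrix.mulVecBilin (ZMod 2) (ZMod 2)).flip b).toAddMonoidHom fun t =>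
      ⟨Matrix.vecMulVec t (Pi.single j (b j)⁻¹), ?_⟩
  simp [Matrix.vecMulVec_mulVec, inv_mul_cancel₀ hj]

theorem bernoulliBit_bind_map_add (p α : I) :
    ((bernoulliBit p).bind fun b => (bernoulliBit α).map (b + ·)) =
      bernoulliBit (bscComp p α) := by
  have hp₀ := p.2.1
  have hp₁ := sub_nonneg.2 p.2.2
  have hα₀ := α.2.1
  have hα₁ := sub_nonneg.2 α.2.2
  ext x
  rw [bind_map_add_apply, tsum_fintype, show (Finset.univ : Finset (ZMod 2)) = {0, 1} from rfl,
    Finset.sum_pair zero_ne_one]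
  fin_cases x
  · change bernoulliBit p 0 * bernoulliBit α 0 + bernoulliBit p 1 * bernoulliBit α 1 =
      bernoulliBit (bscComp p α) 0
    simp only [bernoulliBit_zero, bernoulliBit_one, bscComp]
    rw [← ENNReal.ofReal_mul hp₁, ← ENNReal.ofReal_mul hp₀,
      ← ENNReal.ofReal_add (mul_nonneg hp₁ hα₁) (mul_nonneg hp₀ hα₀)]
    ring_nf
  · change bernoulliBit p 0 * bernoulliBit α 1 + bernoulliBit p 1 * bernoulliBit α 0 =
      bernoulliBit (bscComp p α) 1
    simp only [bernoulliBit_zero, bernoulliBit_one, bscComp]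
    rw [← ENNReal.ofReal_mul hp₁, ← ENNReal.ofReal_mul hp₀,
      ← ENNReal.ofReal_add (mul_nonneg hp₁ hα₀) (mul_nonneg hp₀ hα₁)]
    ring_nf

theorem bernoulliVec_bind_map_add (p α : I) (n : ℕ) :
    ((bernoulliVec p n).bind fun N => (bernoulliVec α n).map (N + ·)) =
      bernoulliVec (bscComp p α) n := by
  ext x
  simp only [bind_map_add_apply, bernoulliVec_apply_eq_prod, ← bernoulliBit_bind_map_add,
    tsum_fintype, Pi.sub_apply, ← Finset.prod_mul_distrib]
  rw [Finset.prod_univ_sum, Fintype.piFinset_univ]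

end Bernoulli

section Exponents

theorem two_pow_coe (x : ℝ) : two_pow (x : EReal) = ENNReal.ofReal (2 ^ x) := by
  rw [two_pow, ← EReal.coe_mul, EReal.exp_coe, Real.rpow_def_of_pos two_pos, mul_comm]

theorem two_pow_mono : Monotone two_pow := fun _ _ h =>
  EReal.exp_monotone <| mul_le_mul_of_nonneg_right h <|
    EReal.coe_nonneg.2 (Real.log_nonneg one_le_two)

theorem two_pow_zero : two_pow 0 = 1 := by
  rw [two_pow, zero_mul, EReal.exp_zero]

theorem two_pow_bot : two_pow ⊥ = 0 := by
  rw [two_pow, EReal.bot_mul_coe_of_pos (Real.log_pos one_lt_two), EReal.exp_bot]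

theorem two_pow_add (x y : EReal) : two_pow (x + y) = two_pow x * two_pow y := by
  rw [two_pow, EReal.right_distrib_of_nonneg_of_ne_top
    (EReal.coe_nonneg.2 (Real.log_nonneg one_le_two)) (EReal.coe_ne_top _), EReal.exp_add]
  rfl

theorem two_pow_neg_natCast (m : ℕ) : two_pow ((-m : ℝ) : EReal) = ((2 : ℝ≥0∞) ^ m)⁻¹ := by
  rw [two_pow_coe, Real.rpow_neg two_pos.le, Real.rpow_natCast,
    ENNReal.ofReal_inv_of_pos (by positivity), ENNReal.ofReal_pow two_pos.le, ENNReal.ofReal_ofNat]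

theorem two_pow_logb_natCast_add_one (n : ℕ) :
    two_pow (Real.logb 2 (n + 1) : ℝ) = n + 1 := by
  rw [two_pow_coe, Real.rpow_logb two_pos (by norm_num) n.cast_add_one_pos]
  norm_cast

theorem two_rpow_neg_mul_logb_div {p q : ℝ} (hp : 0 ≤ p) (hq : 0 ≤ q) (hpq : p = 0 → q = 0)
    (x : ℝ) : (2 : ℝ) ^ (-(x * (q * Real.logb 2 (q / p)))) = (p / q) ^ (x * q) := by
  rcases hq.eq_or_lt' with rfl | hq
  · simp
  have hp : 0 < p := hp.lt_of_ne' fun h => hq.ne' (hpq h)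
  calc (2 : ℝ) ^ (-(x * (q * Real.logb 2 (q / p)))) = 2 ^ (Real.logb 2 (p / q) * (x * q)) := by
        rw [← inv_div, Real.logb_inv]
        ring_nf
    _ = (p / q) ^ (x * q) := by
        rw [Real.rpow_mul two_pos.le, Real.rpow_logb two_pos (by norm_num) (div_pos hp hq)]

-- At `q = 0` and `q = 1` the junk value `x / 0 = 0` is harmless: it is raised to the power `0`.
theorem two_pow_neg_mul_klBits (p q : I) (n : ℕ) :
    two_pow (-(n * klBits q p)) = ENNReal.ofReal
      ((p / q : ℝ) ^ (n * q : ℝ) * ((1 - p) / (1 - q) : ℝ) ^ (n * (1 - q) : ℝ)) := by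
  obtain ⟨p, hp₀, hp₁⟩ := p
  obtain ⟨q, hq₀, hq₁⟩ := q
  dsimp only
  by_cases hac : (p = 0 ∧ q ≠ 0) ∨ (p = 1 ∧ q ≠ 1)
  · rw [klBits, if_pos hac]
    rcases n.eq_zero_or_pos with rfl | hn
    · simp [two_pow_zero]
    rw [EReal.mul_top_of_pos (by exact_mod_cast hn), EReal.neg_top, two_pow_bot, eq_comm,
      ENNReal.ofReal_eq_zero]
    have hn' : (n : ℝ) ≠ 0 := by exact_mod_cast hn.ne'
    rcases hac with ⟨rfl, hq⟩ | ⟨rfl, hq⟩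
    · rw [zero_div, Real.zero_rpow (mul_ne_zero hn' hq), zero_mul]
    · rw [sub_self, zero_div, Real.zero_rpow (mul_ne_zero hn' (sub_ne_zero.2 (Ne.symm hq))),
        mul_zero]
  · push Not at hac
    rw [klBits, if_neg (by push Not; exact hac),
      ← two_rpow_neg_mul_logb_div hp₀ hq₀ hac.1,
      ← two_rpow_neg_mul_logb_div (sub_nonneg.2 hp₁) (sub_nonneg.2 hq₁) fun h => by
        rw [hac.2 (sub_eq_zero.1 h).symm, sub_self],
      ← Real.rpow_add two_pos, ← neg_add, ← mul_add, ← two_pow_coe, EReal.coe_neg, EReal.coe_mul,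
      EReal.coe_natCast]

theorem pow_le_pow_mul_div_rpow {a b x : ℝ} {w : ℕ} (ha : 0 ≤ a) (hb : 0 ≤ b) (hx : 0 ≤ x)
    (hbx : b = 0 → x = 0) (h : a ≤ b ∧ x ≤ w ∨ b ≤ a ∧ w ≤ x) :
    a ^ w ≤ b ^ w * (a / b) ^ x := by
  rcases hb.eq_or_lt' with rfl | hb
  · obtain rfl := hbx rfl
    rcases h with ⟨hab, -⟩ | ⟨-, hwx⟩
    · simp [hab.antisymm ha]
    · simp [Nat.cast_eq_zero.1 (hwx.antisymm w.cast_nonneg)]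
  have hratio : (a / b) ^ (w : ℝ) ≤ (a / b) ^ x := by
    rcases h with ⟨hab, hxw⟩ | ⟨hba, hwx⟩
    · exact Real.rpow_le_rpow_of_exponent_ge' (by positivity) (div_le_one_of_le₀ hab hb.le) hx hxw
    · exact Real.rpow_le_rpow_of_exponent_le ((one_le_div hb).2 hba) hwx
  calc a ^ w = b ^ w * (a / b) ^ (w : ℝ) := by
        rw [Real.rpow_natCast, ← mul_pow, mul_div_cancel₀ _ hb.ne']
    _ ≤ b ^ w * (a / b) ^ x := by gcongr

theorem bernoulliVec_le_mul_two_pow {p q : I} {n : ℕ} {x : Bits n}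
    (h : (p ≤ q ∧ (n * q : ℝ) ≤ hammingNorm x) ∨ (q ≤ p ∧ (hammingNorm x : ℝ) ≤ n * q)) :
    bernoulliVec p n x ≤ bernoulliVec q n x * two_pow (-(n * klBits q p)) := by
  have hcast : ((n - hammingNorm x : ℕ) : ℝ) = n - hammingNorm x :=
    Nat.cast_sub (hammingNorm_le n x)
  have hones := pow_le_pow_mul_div_rpow (w := hammingNorm x) p.2.1 q.2.1
    (mul_nonneg n.cast_nonneg q.2.1) (fun h => by rw [h, mul_zero]) h
  have hzeros := pow_le_pow_mul_div_rpow (w := n - hammingNorm x) (sub_nonneg.2 p.2.2)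
    (sub_nonneg.2 q.2.2) (mul_nonneg n.cast_nonneg (sub_nonneg.2 q.2.2))
    (fun h => by rw [h, mul_zero]) <| h.symm.imp
      (fun h => ⟨sub_le_sub_left (Subtype.coe_le_coe.2 h.1) 1, by rw [hcast]; linarith [h.2]⟩)
      (fun h => ⟨sub_le_sub_left (Subtype.coe_le_coe.2 h.1) 1, by rw [hcast]; linarith [h.2]⟩)
  have hq := sub_nonneg.2 q.2.2
  have hp := sub_nonneg.2 p.2.2
  have hq₀ := q.2.1
  rw [bernoulliVec_apply, bernoulliVec_apply, two_pow_neg_mul_klBits,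
    ← ENNReal.ofReal_mul (by positivity)]
  refine ENNReal.ofReal_le_ofReal ((mul_le_mul hones hzeros (by positivity) ?_).trans_eq
    (mul_mul_mul_comm _ _ _ _))
  exact (pow_nonneg p.2.1 _).trans hones

theorem toOuterMeasure_bernoulliVec_le_two_pow {p q : I} {n : ℕ} {s : Set (Bits n)}
    (h : ∀ x ∈ s, (p ≤ q ∧ (n * q : ℝ) ≤ hammingNorm x) ∨
      (q ≤ p ∧ (hammingNorm x : ℝ) ≤ n * q)) :
    (bernoulliVec p n).toOuterMeasure s ≤ two_pow (-(n * klBits q p)) :=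
  toOuterMeasure_le_of_apply_le_mul fun x hx => bernoulliVec_le_mul_two_pow (h x hx)

theorem klBits_one_half (q : ℝ) : klBits q (1 / 2) = ((1 - hb q : ℝ) : EReal) := by
  have hlog2 := (Real.log_pos one_lt_two).ne'
  have hlog (x : ℝ) : x * Real.logb 2 (x / (1 / 2)) = x + x * Real.log x / Real.log 2 := by
    rcases eq_or_ne x 0 with rfl | hx
    · simp
    rw [Real.logb, div_div_eq_mul_div, div_one, Real.log_mul hx two_ne_zero]
    field_simp
    ring
  rw [klBits, if_neg (by norm_num), EReal.coe_eq_coe_iff, sub_half, hlog, hlog, hb,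
    Real.binEntropy_eq_negMulLog_add_negMulLog_one_sub, Real.negMulLog, Real.negMulLog]
  ring

open Classical in
/-- The Hamming ball of real radius `r` about the origin. -/
noncomputable def hammingBall (n : ℕ) (r : ℝ) : Finset (Bits n) :=
  {x | (hammingNorm x : ℝ) ≤ r}

theorem mem_hammingBall {n : ℕ} {r : ℝ} {x : Bits n} :
    x ∈ hammingBall n r ↔ (hammingNorm x : ℝ) ≤ r := by
  simp [hammingBall]

theorem card_hammingBall_le {q : I} (hq : (q : ℝ) ≤ 1 / 2) (n : ℕ) :
    ((hammingBall n (q * n)).card : ℝ≥0∞) ≤ two_pow ((n * hb q : ℝ) : EReal) := by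
  have htail : (fairVec n).toOuterMeasure (hammingBall n (q * n)) ≤
      two_pow (-(n * klBits q (1 / 2))) :=
    toOuterMeasure_bernoulliVec_le_two_pow fun x hx =>
      Or.inr ⟨Subtype.coe_le_coe.1 hq, (mem_hammingBall.1 hx).trans_eq (mul_comm _ _)⟩
  have hcount : (fairVec n).toOuterMeasure (hammingBall n (q * n)) =
      (hammingBall n (q * n)).card / 2 ^ n := by
    rw [fairVec_eq_uniformOfFintype, PMF.toOuterMeasure_uniformOfFintype_apply]
    simp
  have hsplit : (-(n * klBits q (1 / 2)) : EReal) =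
      ((n * hb q : ℝ) : EReal) + ((-n : ℝ) : EReal) := by
    rw [klBits_one_half, ← EReal.coe_natCast, ← EReal.coe_mul, ← EReal.coe_neg, ← EReal.coe_add]
    ring_nf
  rw [hcount, hsplit, two_pow_add, two_pow_neg_natCast, ENNReal.div_eq_inv_mul, mul_comm] at htail
  exact (ENNReal.mul_le_mul_iff_left (by simp) (by simp)).1 htail

theorem two_pow_mul_le_two_pow_errorExponent (p R : ℝ) {q : ℝ} (hq : q ∈ Set.Icc (0 : ℝ) 1)
    (n : ℕ) :
    two_pow (-(n * klBits q p)) * two_pow ((-(n * max (1 - hb q - R) 0) : ℝ) : EReal) ≤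
      two_pow (-(n * errorExponent p R)) := by
  rw [← two_pow_add]
  refine two_pow_mono ?_
  calc -(n * klBits q p) + ((-(n * max (1 - hb q - R) 0) : ℝ) : EReal)
      = -(n * (klBits q p + ((max (1 - hb q - R) 0 : ℝ) : EReal))) := by
        rw [EReal.left_distrib_of_nonneg_of_ne_top n.cast_nonneg' (EReal.natCast_ne_top n),
          ← EReal.coe_natCast, ← EReal.coe_mul, EReal.neg_add (Or.inr (EReal.coe_ne_top _))
          (Or.inr (EReal.coe_ne_bot _)), EReal.coe_neg, ← sub_eq_add_neg]
    _ ≤ -(n * errorExponent p R) :=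
        EReal.neg_le_neg_iff.2 <| mul_le_mul_of_nonneg_left (iInf₂_le q hq) n.cast_nonneg'

theorem isLittleO_logb_natCast_add_one :
    (fun n : ℕ => Real.logb 2 (n + 1)) =o[Filter.atTop] (fun n : ℕ => (n : ℝ)) := by
  have hcast := tendsto_natCast_atTop_atTop (R := ℝ)
  have hlog : (fun n : ℕ => Real.logb 2 (n + 1)) =o[Filter.atTop] (fun n : ℕ => (n : ℝ) + 1) := by
    have hlog_id := Real.isLittleO_log_id_atTop.comp_tendsto
      (Filter.tendsto_atTop_add_const_right _ (1 : ℝ) hcast)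
    simp only [Real.logb, div_eq_inv_mul]
    exact hlog_id.const_mul_left (Real.log 2)⁻¹
  have hone : (fun _ : ℕ => (1 : ℝ)) =o[Filter.atTop] (fun n : ℕ => (n : ℝ)) :=
    (Asymptotics.isLittleO_const_id_atTop (1 : ℝ)).comp_tendsto hcast
  exact hlog.trans_isBigO ((Asymptotics.isBigO_refl _ _).add hone.isBigO)

end Exponents

namespace System

variable {n m : ℕ} {S K : Type}

theorem law_eq (sys : System n S K) (p₁ α : I) :
    sys.law p₁ α = (fairVec n).bind fun A => (bernoulliVec (bscComp p₁ α) n).bind fun N =>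
      (sys.enroll A).map fun sk => (A, A + N, sk.1, sk.2) := by
  set F : Bits n → Bits n → PMF (Bits n × Bits n × S × K) := fun A N =>
    (sys.enroll A).map fun sk => (A, A + N, sk.1, sk.2) with hF
  have hprobe (A₀ N₁ N₂ : Bits n) : A₀ + N₁ + (N₁ + N₂) = A₀ + N₂ := by
    rw [add_assoc, ← add_assoc N₁, ZModModule.add_self, zero_add]
  calc sys.law p₁ α
      = (bernoulliVec p₁ n).bind fun N₁ => (bernoulliVec α n).bind fun N₂ =>
          (fairVec n).bind fun A₀ => F (A₀ + N₁) (N₁ + N₂) := by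
        simp only [law, hF, hprobe, PMF.bind_comm (fairVec n)]
        rfl
    _ = (bernoulliVec p₁ n).bind fun N₁ => (bernoulliVec α n).bind fun N₂ =>
          (fairVec n).bind fun A => F A (N₁ + N₂) := by
        congr! 4 with N₁ N₂
        conv_rhs => rw [← fairVec_map_add_left n N₁, PMF.bind_map]
        simp only [Function.comp_def, add_comm N₁]
    _ = (fairVec n).bind fun A => (bernoulliVec (bscComp p₁ α) n).bind (F A) := by
        simp only [← bernoulliVec_bind_map_add, PMF.bind_bind, PMF.bind_map,
          PMF.bind_comm (fairVec n)]
        rfl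

theorem law_bind_ignoring_probe {β : Type*} (sys : System n S K) (p₁ α : I)
    (f : Bits n → S → K → PMF β) :
    ((sys.law p₁ α).bind fun x => f x.1 x.2.2.1 x.2.2.2) =
      (fairVec n).bind fun A => (sys.enroll A).bind fun sk => f A sk.1 sk.2 := by
  simp only [law_eq, PMF.bind_bind, PMF.bind_map, PMF.bind_const, Function.comp_def]

theorem PSA_eq_one_of_attack (sys : System n S K) (p₁ α : I) (V : Set Datum)
    (attack : Option (Bits n) × Option S × Option K → Bits n × K)
    (h : ∀ A, ∀ sk ∈ (sys.enroll A).support,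
      sys.verify (attack (view V A sk.1 sk.2)).1 (attack (view V A sk.1 sk.2)).2 sk.1 = true) :
    sys.PSA p₁ α V = 1 := by
  have haccept : ((sys.law p₁ α).bind fun x =>
      (PMF.pure (attack (view V x.1 x.2.2.1 x.2.2.2))).map fun CJ =>
        sys.verify CJ.1 CJ.2 x.2.2.1) = PMF.pure true := by
    rw [sys.law_bind_ignoring_probe p₁ α fun A s k =>
      (PMF.pure (attack (view V A s k))).map fun CJ => sys.verify CJ.1 CJ.2 s]
    have henroll (A : Bits n) : ((sys.enroll A).bind fun sk =>
        (PMF.pure (attack (view V A sk.1 sk.2))).map fun CJ => sys.verify CJ.1 CJ.2 sk.1) =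
        PMF.pure true := by
      rw [bind_congr_of_mem_support (g := fun _ => PMF.pure true) fun sk hsk => by
        rw [PMF.pure_map, h A sk hsk], PMF.bind_const]
    simp only [henroll, PMF.bind_const]
  refine le_antisymm (iSup_le fun adv => PMF.coe_le_one _ _) ?_
  refine le_iSup_of_le (fun v => PMF.pure (attack v)) ?_
  rw [← PMF.pure_apply_self true]
  exact (DFunLike.congr_fun haccept true).ge

/-- The common form of the four systems: enrollment stores a key-masked syndrome of `A`, and
verification tests the unmasked syndrome difference `H (D + A)` with `δ`. Here `κ` is the law of the
key, and `keySyn`, `storedSyn` read off a key and the stored data the corresponding syndromes. -/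
structure IsSyndromeTest (sys : System n S K) (H : Matrix (Fin m) (Fin n) (ZMod 2)) (κ : PMF K)
    (keySyn : K → Bits m) (storedSyn : S → Bits m) (δ : Bits m → Bool) : Prop where
  verify_eq : ∀ D L s, sys.verify D L s = δ (H.mulVec D + keySyn L + storedSyn s)
  map_key : ∀ A, (sys.enroll A).map Prod.snd = κ
  storedSyn_eq : ∀ A, ∀ sk ∈ (sys.enroll A).support, storedSyn sk.1 = H.mulVec A + keySyn sk.2

namespace IsSyndromeTest

variable {sys : System n S K} {H : Matrix (Fin m) (Fin n) (ZMod 2)} {κ : PMF K}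
  {keySyn : K → Bits m} {storedSyn : S → Bits m} {δ : Bits m → Bool}

theorem enroll_bind {β : Type*} (h : sys.IsSyndromeTest H κ keySyn storedSyn δ) (A : Bits n)
    (f : K → Bits m → PMF β) :
    ((sys.enroll A).bind fun sk => f sk.2 (storedSyn sk.1)) =
      κ.bind fun k => f k (H.mulVec A + keySyn k) := by
  rw [bind_congr_of_mem_support fun sk hsk => by rw [h.storedSyn_eq A sk hsk], ← h.map_key A,
    PMF.bind_map]
  rfl

theorem PFR_eq (h : sys.IsSyndromeTest H κ keySyn storedSyn δ) (p₁ α : I) :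
    sys.PFR p₁ α = (bernoulliVec (bscComp p₁ α) n).map (fun N => δ (H.mulVec N)) false := by
  have hverify (A N : Bits n) : ((sys.enroll A).bind fun sk =>
      PMF.pure (sys.verify (A + N) sk.2 sk.1)) = PMF.pure (δ (H.mulVec N)) := by
    have hcancel (k : K) :
        H.mulVec A + H.mulVec N + keySyn k + (H.mulVec A + keySyn k) = H.mulVec N := by
      rw [show H.mulVec A + H.mulVec N + keySyn k + (H.mulVec A + keySyn k) =
        H.mulVec N + (H.mulVec A + H.mulVec A) + (keySyn k + keySyn k) by abel]
      simp only [ZModModule.add_self, add_zero]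
    simp only [h.verify_eq, Matrix.mulVec_add]
    rw [h.enroll_bind A fun k t => PMF.pure (δ (H.mulVec A + H.mulVec N + keySyn k + t))]
    simp only [hcancel, PMF.bind_const]
  simp only [PFR, law_eq, PMF.map, PMF.bind_bind, PMF.pure_bind, Function.comp_def, hverify,
    PMF.bind_const]

theorem fairVec_bind_translate {ι : Type*} (ν : PMF ι) (u : ι → Bits m) :
    ((fairVec m).bind fun t => ν.map fun z => δ (u z + t)) = (fairVec m).map δ := by
  have htranslate (z : ι) : ((fairVec m).bind fun t => PMF.pure (δ (u z + t))) =
      (fairVec m).map δ := by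
    conv_rhs => rw [← fairVec_map_add_left m (u z), PMF.map_comp]
    rfl
  simp only [PMF.map, Function.comp_def, PMF.bind_comm (fairVec m)]
  simp only [htranslate, PMF.bind_const]
  rfl

theorem law_bind_of_key_attack (h : sys.IsSyndromeTest H κ keySyn storedSyn δ)
    (hH : Function.Surjective H.mulVec) (p₁ α : I) (attack : K → PMF (Bits n × K)) :
    ((sys.law p₁ α).bind fun x => (attack x.2.2.2).map fun CJ => sys.verify CJ.1 CJ.2 x.2.2.1) =
      (fairVec m).map δ := by
  have hkey (k : K) : ((fairVec n).bind fun A =>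
      (attack k).map fun CJ => δ (H.mulVec CJ.1 + keySyn CJ.2 + (H.mulVec A + keySyn k))) =
      (fairVec m).map δ := by
    rw [← fairVec_bind_translate (attack k) fun CJ => H.mulVec CJ.1 + keySyn CJ.2 + keySyn k,
      ← fairVec_map_mulVec hH, PMF.bind_map]
    simp only [Function.comp_def, add_assoc, add_comm (keySyn k)]
  rw [sys.law_bind_ignoring_probe p₁ α fun _ s k =>
    (attack k).map fun CJ => sys.verify CJ.1 CJ.2 s]
  have henroll (A : Bits n) := h.enroll_bind A fun k t =>
    (attack k).map fun CJ => δ (H.mulVec CJ.1 + keySyn CJ.2 + t)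
  simp only [h.verify_eq, henroll]
  rw [PMF.bind_comm]
  simp only [hkey, PMF.bind_const]

theorem law_bind_of_bio_attack (h : sys.IsSyndromeTest H κ keySyn storedSyn δ)
    (hκ : κ.map keySyn = fairVec m) (p₁ α : I) (attack : Bits n → PMF (Bits n × K)) :
    ((sys.law p₁ α).bind fun x => (attack x.1).map fun CJ => sys.verify CJ.1 CJ.2 x.2.2.1) =
      (fairVec m).map δ := by
  have hbio (A : Bits n) : (κ.bind fun k =>
      (attack A).map fun CJ => δ (H.mulVec CJ.1 + keySyn CJ.2 + (H.mulVec A + keySyn k))) =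
      (fairVec m).map δ := by
    rw [← fairVec_bind_translate (attack A) fun CJ => H.mulVec CJ.1 + keySyn CJ.2 + H.mulVec A,
      ← hκ, PMF.bind_map]
    simp only [Function.comp_def, add_assoc]
  rw [sys.law_bind_ignoring_probe p₁ α fun A s _ =>
    (attack A).map fun CJ => sys.verify CJ.1 CJ.2 s]
  have henroll (A : Bits n) := h.enroll_bind A fun _ t =>
    (attack A).map fun CJ => δ (H.mulVec CJ.1 + keySyn CJ.2 + t)
  simp only [h.verify_eq, henroll, hbio, PMF.bind_const]

theorem PFA_eq (h : sys.IsSyndromeTest H κ keySyn storedSyn δ)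
    (hH : Function.Surjective H.mulVec) (p₁ α : I) :
    sys.PFA p₁ α = (fairVec m).map δ true := by
  have : Nonempty (PMF (Bits n × K)) := ⟨PMF.pure (0, κ.support_nonempty.some)⟩
  exact (iSup_congr fun adv =>
    DFunLike.congr_fun (h.law_bind_of_key_attack hH p₁ α fun _ => adv) true).trans iSup_const

theorem PSA_key_eq (h : sys.IsSyndromeTest H κ keySyn storedSyn δ)
    (hH : Function.Surjective H.mulVec) (p₁ α : I) :
    sys.PSA p₁ α {Datum.key} = (fairVec m).map δ true := by
  have : Nonempty (PMF (Bits n × K)) := ⟨PMF.pure (0, κ.support_nonempty.some)⟩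
  refine (iSup_congr fun adv => ?_).trans iSup_const
  simpa [view] using DFunLike.congr_fun
    (h.law_bind_of_key_attack hH p₁ α fun k => adv (none, none, some k)) true

theorem PSA_bio_eq (h : sys.IsSyndromeTest H κ keySyn storedSyn δ)
    (hκ : κ.map keySyn = fairVec m) (p₁ α : I) :
    sys.PSA p₁ α {Datum.bio} = (fairVec m).map δ true := by
  have : Nonempty (PMF (Bits n × K)) := ⟨PMF.pure (0, κ.support_nonempty.some)⟩
  refine (iSup_congr fun adv => ?_).trans iSup_const
  simpa [view] using DFunLike.congr_fun
    (h.law_bind_of_bio_attack hκ p₁ α fun A => adv (some A, none, none)) true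

theorem PSA_eq_one_of_stored_mem (h : sys.IsSyndromeTest H κ keySyn storedSyn δ)
    (hH : Function.Surjective H.mulVec) (hδ : δ 0 = true) (p₁ α : I) {V : Set Datum}
    (hV : Datum.stored ∈ V) : sys.PSA p₁ α V = 1 := by
  obtain ⟨k₀, -⟩ := κ.support_nonempty
  choose preimage hpreimage using hH
  refine sys.PSA_eq_one_of_attack p₁ α V
    (fun v => (v.2.1.elim 0 fun s => preimage (keySyn k₀ + storedSyn s), k₀)) fun A sk _ => ?_
  simp only [view, if_pos hV, Option.elim_some, h.verify_eq, hpreimage]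
  rw [add_assoc, ZModModule.add_self, hδ]

theorem PSA_eq_one_of_bio_mem (h : sys.IsSyndromeTest H κ keySyn storedSyn δ) (hδ : δ 0 = true)
    (p₁ α : I) {V : Set Datum} (hbio : Datum.bio ∈ V) (hkey : Datum.key ∈ V ∨ Subsingleton K) :
    sys.PSA p₁ α V = 1 := by
  obtain ⟨k₀, -⟩ := κ.support_nonempty
  refine sys.PSA_eq_one_of_attack p₁ α V (fun v => (v.1.getD 0, v.2.2.getD k₀)) fun A sk hsk => ?_
  have hkey' : (view V A sk.1 sk.2).2.2.getD k₀ = sk.2 := by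
    rcases hkey with hkey | _
    · simp only [view, if_pos hkey, Option.getD_some]
    · exact Subsingleton.elim _ _
  rw [hkey', h.verify_eq, h.storedSyn_eq A sk hsk]
  simp only [view, if_pos hbio, Option.getD_some, ZModModule.add_self, hδ]

theorem PSA_eq_one (h : sys.IsSyndromeTest H κ keySyn storedSyn δ)
    (hH : Function.Surjective H.mulVec) (hδ : δ 0 = true) (p₁ α : I) {V : Set Datum}
    (hV : Datum.stored ∈ V ∨ Datum.bio ∈ V ∧ (Datum.key ∈ V ∨ Subsingleton K)) :
    sys.PSA p₁ α V = 1 :=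
  hV.elim (h.PSA_eq_one_of_stored_mem hH hδ p₁ α) fun hV =>
    h.PSA_eq_one_of_bio_mem hδ p₁ α hV.1 hV.2

end IsSyndromeTest
end System

namespace LinCode

variable {n k m : ℕ}

section SyndromeTests

variable (c : LinCode n k m) {dec : Bits m → Bits n} {τ : ℝ}

theorem H_mulVec_G_transpose_mulVec (z : Bits k) :
    c.H.mulVec (c.G.transpose.mulVec z) = 0 := by
  rw [Matrix.mulVec_mulVec, c.ortho, Matrix.zero_mulVec]

theorem H_mulVec_surjective : Function.Surjective c.H.mulVec := by
  have hrank : c.H.rank = m := by simpa using c.H_rank.rank_matrix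
  have hrange : LinearMap.range c.H.mulVecLin = ⊤ := Submodule.eq_top_of_finrank_eq <| by
    rw [← Matrix.rank, hrank, Module.finrank_fin_fun]
  exact LinearMap.range_eq_top.1 hrange

theorem exists_isDecoder : ∃ dec, c.IsDecoder dec := by
  choose dec hdec using fun s : Bits m =>
    ({W | c.H.mulVec W = s} : Set (Bits n)).toFinite.exists_minimalFor hammingNorm _
      (c.H_mulVec_surjective s)
  exact ⟨dec, fun s => ⟨(hdec s).1, fun W hW => (le_total _ _).elim id ((hdec s).2 hW)⟩⟩

theorem IsDecoder.injective {c : LinCode n k m} (hdec : c.IsDecoder dec) :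
    Function.Injective dec :=
  Function.LeftInverse.injective fun s => (hdec s).1

theorem IsDecoder.threshold_zero {c : LinCode n k m} (hdec : c.IsDecoder dec) (hτ : 0 ≤ τ) :
    threshold τ (dec 0) = true := by
  have hzero : dec 0 = 0 := by
    simpa using (hdec 0).2 0 (Matrix.mulVec_zero _)
  simpa [hzero, threshold] using mul_nonneg hτ n.cast_nonneg

variable (dec τ)

theorem fuzzyKeyed_isSyndromeTest :
    (c.fuzzyKeyed dec τ).IsSyndromeTest c.H (fairVec n) c.H.mulVec c.H.mulVec
      fun t => threshold τ (dec t) where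
  verify_eq D L s := by simp only [fuzzyKeyed, Matrix.mulVec_add]
  map_key A := by
    simp only [fuzzyKeyed, PMF.map_bind, PMF.map_comp]
    exact (congrArg _ (funext fun K => PMF.map_const _ K)).trans (PMF.bind_pure _)
  storedSyn_eq A sk hsk := by
    simp only [fuzzyKeyed, PMF.mem_support_bind_iff, PMF.mem_support_map_iff] at hsk
    obtain ⟨K, -, Z, -, rfl⟩ := hsk
    simp only [Matrix.mulVec_add, H_mulVec_G_transpose_mulVec, add_zero]

theorem fuzzyKeyless_isSyndromeTest :
    (c.fuzzyKeyless dec τ).IsSyndromeTest c.H (PMF.pure ()) 0 c.H.mulVec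
      fun t => threshold τ (dec t) where
  verify_eq D L s := by simp only [fuzzyKeyless, Matrix.mulVec_add, Pi.zero_apply, add_zero]
  map_key A := by
    simp only [fuzzyKeyless, PMF.map_comp]
    exact PMF.map_const _ ()
  storedSyn_eq A sk hsk := by
    simp only [fuzzyKeyless, PMF.mem_support_map_iff] at hsk
    obtain ⟨Z, -, rfl⟩ := hsk
    simp only [Matrix.mulVec_add, H_mulVec_G_transpose_mulVec, Pi.zero_apply]

theorem sketchKeyed_isSyndromeTest :
    (c.sketchKeyed dec τ).IsSyndromeTest c.H (fairVec m) id id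
      fun t => threshold τ (dec t) where
  verify_eq D L s := rfl
  map_key A := by
    simp only [sketchKeyed, PMF.map_comp, Function.comp_def]
    exact PMF.map_id _
  storedSyn_eq A sk hsk := by
    simp only [sketchKeyed, PMF.mem_support_map_iff] at hsk
    obtain ⟨K, -, rfl⟩ := hsk
    rfl

theorem sketchKeyless_isSyndromeTest :
    (c.sketchKeyless dec τ).IsSyndromeTest c.H (PMF.pure ()) 0 id
      fun t => threshold τ (dec t) where
  verify_eq D L s := by simp only [sketchKeyless, Pi.zero_apply, add_zero, id]
  map_key A := by simp only [sketchKeyless, PMF.pure_map]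
  storedSyn_eq A sk hsk := by
    simp only [sketchKeyless, PMF.mem_support_pure_iff] at hsk
    simp only [hsk, id, Pi.zero_apply, add_zero]

end SyndromeTests

theorem IsDecoder.map_threshold_false_le {c : LinCode n k m} {dec : Bits m → Bits n}
    (hdec : c.IsDecoder dec) {p q : I} (hpq : p ≤ q) :
    (bernoulliVec p n).map (fun N => threshold q (dec (c.H.mulVec N))) false ≤
      two_pow (-(n * klBits q p)) := by
  rw [map_apply_eq_toOuterMeasure]
  refine toOuterMeasure_bernoulliVec_le_two_pow fun N hN => Or.inl ⟨hpq, ?_⟩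
  have hheavy : (q * n : ℝ) < hammingNorm (dec (c.H.mulVec N)) := by
    simpa [threshold] using hN
  rw [mul_comm]
  exact hheavy.le.trans (Nat.cast_le.2 ((hdec _).2 N rfl))

theorem IsDecoder.map_threshold_true_le {c : LinCode n k m} {dec : Bits m → Bits n}
    (hdec : c.IsDecoder dec) {q : I} (hq : (q : ℝ) ≤ 1 / 2) :
    (fairVec m).map (fun t => threshold q (dec t)) true ≤
      two_pow ((-(n * ((m : ℝ) / n - hb q)) : ℝ) : EReal) := by
  classical
  have hcard : Fintype.card {t | threshold q (dec t) = true} ≤ (hammingBall n (q * n)).card := by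
    rw [← Set.toFinset_card]
    refine Finset.card_le_card_of_injOn dec (fun t ht => ?_) hdec.injective.injOn
    simpa [threshold, mem_hammingBall] using ht
  have hnm : (n : ℝ) * (m / n) = m := mul_div_cancel_of_imp' fun hn => by
    have hm := c.dim
    rw [Nat.cast_eq_zero] at hn ⊢
    omega
  have hexp : (-(n * ((m : ℝ) / n - hb q)) : ℝ) = n * hb q + -m := by
    rw [mul_sub, hnm]
    ring
  rw [map_apply_eq_toOuterMeasure, fairVec_eq_uniformOfFintype,
    PMF.toOuterMeasure_uniformOfFintype_apply, hexp, EReal.coe_add, two_pow_add,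
    two_pow_neg_natCast, div_eq_mul_inv]
  gcongr
  · exact (Nat.cast_le.2 hcard).trans (card_hammingBall_le hq n)
  · simp

/-- The `[n, k]` code in systematic form with parity block `P`: its codewords are the vectors whose
restrictions `x`, `y` to the `k` information and the `m` check positions satisfy `y = P x`. The
bijection `e` chooses these positions. -/
def systematic (e : Fin k ⊕ Fin m ≃ Fin n) (P : Matrix (Fin m) (Fin k) (ZMod 2)) :
    LinCode n k m where
  G := (Matrix.fromCols 1 P.transpose).submatrix id e.symm
  H := (Matrix.fromCols P 1).submatrix id e.symm
  dim := by simpa using Fintype.card_congr e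
  G_rank := by
    rw [← Matrix.vecMul_injective_iff]
    refine fun v w hvw => funext fun i => ?_
    have hi := congrFun hvw (e (Sum.inl i))
    simpa [Matrix.vecMul, dotProduct, Matrix.one_apply] using hi
  H_rank := by
    rw [← Matrix.vecMul_injective_iff]
    refine fun v w hvw => funext fun i => ?_
    have hi := congrFun hvw (e (Sum.inr i))
    simpa [Matrix.vecMul, dotProduct, Matrix.one_apply] using hi
  ortho := by
    rw [Matrix.transpose_submatrix, Matrix.submatrix_mul_equiv, Matrix.transpose_fromCols,
      Matrix.fromCols_mul_fromRows, Matrix.transpose_one, Matrix.transpose_transpose,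
      Matrix.mul_one, Matrix.one_mul, ZModModule.add_self, Matrix.submatrix_zero]
    rfl

theorem systematic_H_mulVec (e : Fin k ⊕ Fin m ≃ Fin n) (P : Matrix (Fin m) (Fin k) (ZMod 2))
    (x : Bits n) :
    (systematic e P).H.mulVec x =
      P.mulVec (fun j => x (e (Sum.inl j))) + fun i => x (e (Sum.inr i)) := by
  have h := Matrix.submatrix_mulVec_equiv (Matrix.fromCols P 1) x id e.symm
  rw [Matrix.fromCols_mulVec, Matrix.one_mulVec] at h
  exact h

theorem toOuterMeasure_systematic_mem_le (e : Fin k ⊕ Fin m ≃ Fin n) {v : Bits n} (hv : v ≠ 0) :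
    (PMF.uniformOfFintype (Matrix (Fin m) (Fin k) (ZMod 2))).toOuterMeasure
      {P | (systematic e P).H.mulVec v = 0} ≤ (2 ^ m)⁻¹ := by
  set a : Bits k := fun j => v (e (Sum.inl j)) with ha
  set b : Bits m := fun i => v (e (Sum.inr i)) with hb
  simp only [systematic_H_mulVec, ← ha, ← hb, add_eq_zero_iff_eq_neg]
  by_cases ha₀ : a = 0
  · have hb₀ : b ≠ 0 := fun hb₀ => hv <| funext <| e.surjective.forall.2 <| Sum.forall.2
      ⟨congrFun ha₀, congrFun hb₀⟩
    simp [ha₀, hb₀]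
  · rw [← map_apply_eq_toOuterMeasure, map_mulVec_uniformOfFintype ha₀]
    simp

/-- A noise vector `N` is ambiguous for a code if some other vector of the same syndrome is at most
as heavy. These are the noise vectors that some minimum weight decoder gets wrong. -/
def Ambiguous (c : LinCode n k m) (N : Bits n) : Prop :=
  ∃ W, W ≠ N ∧ c.H.mulVec (W - N) = 0 ∧ hammingNorm W ≤ hammingNorm N

theorem IsDecoder.errorProb_le {c : LinCode n k m} {dec : Bits m → Bits n}
    (hdec : c.IsDecoder dec) (p : I) :
    c.errorProb dec p ≤ (bernoulliVec p n).toOuterMeasure {N | c.Ambiguous N} := by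
  have hsent (Z : Bits k) : ((bernoulliVec p n).map fun N =>
      let X := c.G.transpose.mulVec Z
      let Y := X + N
      decide (Y + dec (c.H.mulVec Y) ≠ X)) =
      (bernoulliVec p n).map fun N => decide (dec (c.H.mulVec N) ≠ N) := by
    refine congrArg (PMF.map · _) (funext fun N => decide_eq_decide.2 (not_congr ?_))
    rw [Matrix.mulVec_add, H_mulVec_G_transpose_mulVec, zero_add, add_assoc, add_eq_left,
      ← ZModModule.sub_eq_add, sub_eq_zero, eq_comm]
  simp only [errorProb, hsent, PMF.bind_const]
  rw [map_apply_eq_toOuterMeasure]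
  refine MeasureTheory.measure_mono fun N hN => ?_
  refine ⟨dec (c.H.mulVec N), of_decide_eq_true hN, ?_, (hdec _).2 N rfl⟩
  rw [Matrix.mulVec_sub, (hdec _).1, sub_self]

/-- The union bound, capped at `1`, for the probability that a noise vector of weight `r` is
ambiguous for a random code of length `n` with `m` parity checks. -/
noncomputable def ambiguityBound (n m : ℕ) (r : ℝ) : ℝ≥0∞ :=
  min 1 ((hammingBall n r).card * (2 ^ m)⁻¹)

theorem toOuterMeasure_systematic_ambiguous_le (e : Fin k ⊕ Fin m ≃ Fin n) (N : Bits n) :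
    (PMF.uniformOfFintype (Matrix (Fin m) (Fin k) (ZMod 2))).toOuterMeasure
      {P | (systematic e P).Ambiguous N} ≤
        ambiguityBound n m (hammingNorm N) := by
  classical
  set μ := PMF.uniformOfFintype (Matrix (Fin m) (Fin k) (ZMod 2))
  set others := (hammingBall n (hammingNorm N)).erase N
  have hone : μ.toOuterMeasure {P | (systematic e P).Ambiguous N} ≤ 1 :=
    toOuterMeasure_le_of_apply_le_mul fun P _ => (mul_one (μ P)).ge
  have hcover : {P | (systematic e P).Ambiguous N} ⊆
      ⋃ W ∈ others, {P | (systematic e P).H.mulVec (W - N) = 0} := by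
    rintro P ⟨W, hWN, hH, hle⟩
    exact Set.mem_biUnion (Finset.mem_erase.2 ⟨hWN, mem_hammingBall.2 (Nat.cast_le.2 hle)⟩) hH
  refine le_min hone ?_
  calc μ.toOuterMeasure {P | (systematic e P).Ambiguous N}
      ≤ ∑ W ∈ others, μ.toOuterMeasure {P | (systematic e P).H.mulVec (W - N) = 0} :=
        (MeasureTheory.measure_mono hcover).trans (MeasureTheory.measure_biUnion_finset_le _ _)
    _ ≤ ∑ W ∈ others, (2 ^ m)⁻¹ := Finset.sum_le_sum fun W hW =>
        toOuterMeasure_systematic_mem_le e (sub_ne_zero.2 (Finset.ne_of_mem_erase hW))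
    _ ≤ (hammingBall n (hammingNorm N)).card * (2 ^ m)⁻¹ := by
        rw [Finset.sum_const, nsmul_eq_mul]
        gcongr
        exact Finset.erase_subset _ _

theorem exists_toOuterMeasure_ambiguous_le (hkm : k + m = n) (p : I) : ∃ c : LinCode n k m,
    (bernoulliVec p n).toOuterMeasure {N | c.Ambiguous N} ≤ ∑' N, bernoulliVec p n N *
      ambiguityBound n m (hammingNorm N) := by
  set e : Fin k ⊕ Fin m ≃ Fin n := finSumFinEquiv.trans (finCongr hkm)
  obtain ⟨P, hP⟩ := exists_le_tsum_mul (PMF.uniformOfFintype (Matrix (Fin m) (Fin k) (ZMod 2)))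
    fun P => (bernoulliVec p n).toOuterMeasure {N | (systematic e P).Ambiguous N}
  refine ⟨systematic e P, hP.trans ?_⟩
  rw [tsum_mul_toOuterMeasure_comm]
  gcongr with N
  exact toOuterMeasure_systematic_ambiguous_le e N

theorem ambiguityBound_le_one (n m : ℕ) (r : ℝ) : ambiguityBound n m r ≤ 1 :=
  min_le_left _ _

theorem ambiguityBound_le (hkm : k + m = n) {q : I}
    (hq : (q : ℝ) ≤ 1 / 2) :
    ambiguityBound n m (q * n) ≤
      two_pow ((-(n * max (1 - hb q - k / n) 0) : ℝ) : EReal) := by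
  rcases max_choice (1 - hb q - (k : ℝ) / n) 0 with hmax | hmax <;> rw [hmax]
  · have hnk : (n : ℝ) * (k / n) = k := mul_div_cancel_of_imp' fun hn => by
      rw [Nat.cast_eq_zero] at hn ⊢
      omega
    have hnm : (n : ℝ) = k + m := by exact_mod_cast hkm.symm
    have hexp : (-(n * (1 - hb q - k / n)) : ℝ) = n * hb q + -m := by
      linear_combination hnk - hnm
    rw [hexp, EReal.coe_add, two_pow_add, two_pow_neg_natCast]
    exact (min_le_right _ _).trans (mul_le_mul_left (card_hammingBall_le hq n) _)
  · rw [mul_zero, neg_zero, EReal.coe_zero, two_pow_zero]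
    exact ambiguityBound_le_one n m _

theorem bernoulliVec_map_hammingNorm_mul_ambiguityBound_le {w : ℕ} (hkm : k + m = n) (hw : w ≤ n)
    {p : I} (hp : (p : ℝ) ≤ 1 / 2) :
    (bernoulliVec p n).map hammingNorm w * ambiguityBound n m w ≤
      two_pow (-(n * errorExponent p (k / n))) := by
  have hwn : (w / n * n : ℝ) = w := div_mul_cancel_of_imp fun hn => by
    rw [Nat.cast_eq_zero] at hn ⊢
    omega
  rw [map_apply_eq_toOuterMeasure]
  rcases le_total (w / n : ℝ) (1 / 2) with hhalf | hhalf
  · set q : I := ⟨w / n, by positivity, hhalf.trans (by norm_num)⟩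
    refine le_trans (mul_le_mul' ?_ ?_) (two_pow_mul_le_two_pow_errorExponent p (k / n) q.2 n)
    · refine toOuterMeasure_bernoulliVec_le_two_pow fun x hx => ?_
      have hx : (hammingNorm x : ℝ) = n * q := by rw [Set.mem_ofPred.1 hx, mul_comm, ← hwn]
      exact (le_total p q).imp (⟨·, hx.ge⟩) (⟨·, hx.le⟩)
    · rw [← hwn]
      exact ambiguityBound_le hkm (q := q) hhalf
  · set q : I := ⟨1 / 2, by norm_num, by norm_num⟩
    refine le_trans (mul_le_mul' ?_ ?_) (two_pow_mul_le_two_pow_errorExponent p (k / n) q.2 n)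
    · refine toOuterMeasure_bernoulliVec_le_two_pow fun x hx => Or.inl ⟨hp, ?_⟩
      rw [Set.mem_ofPred.1 hx, ← hwn, mul_comm]
      gcongr
    · have hmax : max (1 - hb q - (k : ℝ) / n) 0 = 0 := by
        have hhb : hb q = 1 := by
          rw [hb, show (q : ℝ) = 2⁻¹ from one_div 2, Real.binEntropy_two_inv,
            div_self (Real.log_pos one_lt_two).ne']
        rw [hhb, sub_self, zero_sub]
        exact max_eq_right (neg_nonpos.2 (by positivity))
      rw [hmax, mul_zero, neg_zero, EReal.coe_zero, two_pow_zero]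
      exact ambiguityBound_le_one n m w

theorem tsum_bernoulliVec_mul_ambiguityBound_le (hkm : k + m = n) {p : I}
    (hp : (p : ℝ) ≤ 1 / 2) :
    ∑' N, bernoulliVec p n N * ambiguityBound n m (hammingNorm N) ≤
      (n + 1) * two_pow (-(n * errorExponent p (k / n))) := by
  set g : ℕ → ℝ≥0∞ := fun w => ambiguityBound n m w
  calc ∑' N, bernoulliVec p n N * g (hammingNorm N)
      = ∑' w, (bernoulliVec p n).map hammingNorm w * g w := (tsum_map_apply_mul _ _ g).symm
    _ = ∑ w ∈ Finset.range (n + 1), (bernoulliVec p n).map hammingNorm w * g w := by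
        refine tsum_eq_sum fun w hw => mul_eq_zero_of_left ?_ _
        rw [PMF.apply_eq_zero_iff, PMF.mem_support_map_iff]
        rintro ⟨N, -, rfl⟩
        exact hw (Finset.mem_range_succ_iff.2 (hammingNorm_le n N))
    _ ≤ (Finset.range (n + 1)).card • two_pow (-(n * errorExponent p (k / n))) :=
        Finset.sum_le_card_nsmul _ _ _ fun w hw =>
          bernoulliVec_map_hammingNorm_mul_ambiguityBound_le hkm (Finset.mem_range_succ_iff.1 hw) hp
    _ = (n + 1) * two_pow (-(n * errorExponent p (k / n))) := by
        rw [Finset.card_range, nsmul_eq_mul, Nat.cast_succ]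

theorem exists_errorProb_le (hkm : k + m = n) {p : I}
    (hp : (p : ℝ) ≤ 1 / 2) :
    ∃ c : LinCode n k m, ∀ dec, c.IsDecoder dec → c.errorProb dec p ≤
      two_pow (-(n * errorExponent p (k / n)) + (Real.logb 2 (n + 1) : ℝ)) := by
  obtain ⟨c, hc⟩ := exists_toOuterMeasure_ambiguous_le hkm p
  refine ⟨c, fun dec hdec => ?_⟩
  rw [two_pow_add, two_pow_logb_natCast_add_one, mul_comm]
  exact (hdec.errorProb_le p).trans (hc.trans (tsum_bernoulliVec_mul_ambiguityBound_le hkm hp))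

end LinCode

end SecureBiometrics

open SecureBiometrics SecureBiometrics.LinCode SecureBiometrics.Datum in
theorem theorem1_general (p₁ α : I) (τ : ℝ) (hpτ : (bscComp p₁ α : ℝ) ≤ τ) (hτ : τ ≤ 1 / 2) :
    (∀ (n k m : ℕ) (c : LinCode n k m) (dec : Bits m → Bits n), c.IsDecoder dec →
      ((c.fuzzyKeyed dec τ).PFR p₁ α = (c.sketchKeyless dec τ).PFR p₁ α ∧
        (c.fuzzyKeyless dec τ).PFR p₁ α = (c.sketchKeyless dec τ).PFR p₁ α ∧
        (c.sketchKeyed dec τ).PFR p₁ α = (c.sketchKeyless dec τ).PFR p₁ α) ∧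
      ((c.fuzzyKeyed dec τ).PFA p₁ α = (c.sketchKeyless dec τ).PFA p₁ α ∧
        (c.fuzzyKeyless dec τ).PFA p₁ α = (c.sketchKeyless dec τ).PFA p₁ α ∧
        (c.sketchKeyed dec τ).PFA p₁ α = (c.sketchKeyless dec τ).PFA p₁ α) ∧
      (c.sketchKeyless dec τ).PFA p₁ α ≤ two_pow ((-(n * ((m : ℝ) / n - hb τ)) : ℝ) : EReal) ∧
      ((c.fuzzyKeyed dec τ).PSA p₁ α {key} = (c.fuzzyKeyed dec τ).PFA p₁ α ∧
        (c.sketchKeyed dec τ).PSA p₁ α {key} = (c.sketchKeyed dec τ).PFA p₁ α ∧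
        (c.fuzzyKeyed dec τ).PSA p₁ α {bio} = (c.fuzzyKeyed dec τ).PFA p₁ α ∧
        (c.sketchKeyed dec τ).PSA p₁ α {bio} = (c.sketchKeyed dec τ).PFA p₁ α) ∧
      (∀ V ∈ ({{stored}, {bio, key}, {bio, stored}, {stored, key}, {bio, stored, key}} :
          Set (Set Datum)),
        (c.fuzzyKeyed dec τ).PSA p₁ α V = 1 ∧ (c.sketchKeyed dec τ).PSA p₁ α V = 1) ∧
      (∀ V ∈ ({{stored}, {bio}, {bio, stored}} : Set (Set Datum)),
        (c.fuzzyKeyless dec τ).PSA p₁ α V = 1 ∧ (c.sketchKeyless dec τ).PSA p₁ α V = 1)) ∧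
    (∀ (n k m : ℕ) (c : LinCode n k m) (dec : Bits m → Bits n), c.IsDecoder dec →
      (c.sketchKeyless dec τ).PFR p₁ α ≤ two_pow (-((n : EReal) * klBits τ (bscComp p₁ α)))) ∧
    (∃ ε : ℕ → ℝ, ε =o[Filter.atTop] (fun n : ℕ => (n : ℝ)) ∧
      ∀ n k m : ℕ, k + m = n → ∃ c : LinCode n k m, (∃ dec, c.IsDecoder dec) ∧
        ∀ dec, c.IsDecoder dec →
          c.errorProb dec (bscComp p₁ α) ≤
            two_pow (-((n : EReal) * errorExponent (bscComp p₁ α) ((k : ℝ) / n)) +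
              (ε n : EReal))) := by
  set q : I := ⟨τ, (bscComp p₁ α).2.1.trans hpτ, hτ.trans one_half_lt_one.le⟩
  refine ⟨fun n k m c dec hdec => ?_, fun n k m c dec hdec => ?_,
    _, isLittleO_logb_natCast_add_one, fun n k m hkm => ?_⟩
  · have hH := c.H_mulVec_surjective
    have hzero := hdec.threshold_zero q.2.1
    have hfuzzy₂ := c.fuzzyKeyed_isSyndromeTest dec τ
    have hfuzzy₁ := c.fuzzyKeyless_isSyndromeTest dec τ
    have hsketch₂ := c.sketchKeyed_isSyndromeTest dec τ
    have hsketch₁ := c.sketchKeyless_isSyndromeTest dec τ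
    simp only [hfuzzy₂.PFR_eq, hfuzzy₁.PFR_eq, hsketch₂.PFR_eq, hsketch₁.PFR_eq,
      hfuzzy₂.PFA_eq hH, hfuzzy₁.PFA_eq hH, hsketch₂.PFA_eq hH, hsketch₁.PFA_eq hH,
      hfuzzy₂.PSA_key_eq hH, hsketch₂.PSA_key_eq hH, hfuzzy₂.PSA_bio_eq (fairVec_map_mulVec hH),
      hsketch₂.PSA_bio_eq (PMF.map_id _), true_and, and_true]
    refine ⟨hdec.map_threshold_true_le (q := q) hτ, fun V hV => ?_, fun V hV => ?_⟩
    · have hV : stored ∈ V ∨ bio ∈ V ∧ key ∈ V := by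
        rcases hV with rfl | rfl | rfl | rfl | rfl <;> simp
      exact ⟨hfuzzy₂.PSA_eq_one hH hzero p₁ α (hV.imp_right (.imp_right .inl)),
        hsketch₂.PSA_eq_one hH hzero p₁ α (hV.imp_right (.imp_right .inl))⟩
    · have hV : stored ∈ V ∨ bio ∈ V := by rcases hV with rfl | rfl | rfl <;> simp
      have hkeyless : Subsingleton Unit := inferInstance
      exact ⟨hfuzzy₁.PSA_eq_one hH hzero p₁ α (hV.imp_right (⟨·, .inr hkeyless⟩)),
        hsketch₁.PSA_eq_one hH hzero p₁ α (hV.imp_right (⟨·, .inr hkeyless⟩))⟩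
  · rw [(c.sketchKeyless_isSyndromeTest dec τ).PFR_eq]
    exact hdec.map_threshold_false_le (q := q) hpτ
  · obtain ⟨c, hc⟩ := exists_errorProb_le hkm (hpτ.trans hτ)
    exact ⟨c, c.exists_isDecoder, hc⟩

open SecureBiometrics SecureBiometrics.LinCode SecureBiometrics.Datum in
theorem theorem1 (p₁ α : unitInterval) (τ : ℝ) (hp₁ : (p₁ : ℝ) < 1 / 2) (hα : (α : ℝ) < 1 / 2)
    (hpτ : (bscComp p₁ α : ℝ) < τ) (hτ : τ < 1 / 2) :
    -- claims about every code and every decoder of that code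
    (∀ (n k m : ℕ) (c : LinCode n k m) (dec : Bits m → Bits n), c.IsDecoder dec →
      -- the FRR of the four systems is the same
      ((c.fuzzyKeyed dec τ).PFR p₁ α = (c.sketchKeyless dec τ).PFR p₁ α ∧
        (c.fuzzyKeyless dec τ).PFR p₁ α = (c.sketchKeyless dec τ).PFR p₁ α ∧
        (c.sketchKeyed dec τ).PFR p₁ α = (c.sketchKeyless dec τ).PFR p₁ α) ∧
      -- the FAR of the four systems is the same
      ((c.fuzzyKeyed dec τ).PFA p₁ α = (c.sketchKeyless dec τ).PFA p₁ α ∧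
        (c.fuzzyKeyless dec τ).PFA p₁ α = (c.sketchKeyless dec τ).PFA p₁ α ∧
        (c.sketchKeyed dec τ).PFA p₁ α = (c.sketchKeyless dec τ).PFA p₁ α) ∧
      -- (ii)
      (c.sketchKeyless dec τ).PFA p₁ α ≤ two_pow ((-(n * ((m : ℝ) / n - hb τ)) : ℝ) : EReal) ∧
      -- (iii) and (iv)
      ((c.fuzzyKeyed dec τ).PSA p₁ α {key} = (c.fuzzyKeyed dec τ).PFA p₁ α ∧
        (c.sketchKeyed dec τ).PSA p₁ α {key} = (c.sketchKeyed dec τ).PFA p₁ α ∧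
        (c.fuzzyKeyed dec τ).PSA p₁ α {bio} = (c.fuzzyKeyed dec τ).PFA p₁ α ∧
        (c.sketchKeyed dec τ).PSA p₁ α {bio} = (c.sketchKeyed dec τ).PFA p₁ α) ∧
      -- (v)
      (∀ V ∈ ({{stored}, {bio, key}, {bio, stored}, {stored, key}, {bio, stored, key}} :
          Set (Set Datum)),
        (c.fuzzyKeyed dec τ).PSA p₁ α V = 1 ∧ (c.sketchKeyed dec τ).PSA p₁ α V = 1) ∧
      -- (vi)
      (∀ V ∈ ({{stored}, {bio}, {bio, stored}} : Set (Set Datum)),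
        (c.fuzzyKeyless dec τ).PSA p₁ α V = 1 ∧ (c.sketchKeyless dec τ).PSA p₁ α V = 1)) ∧
    -- (i) for every sequence of codes of growing length whose decoding error probability on the
    -- BSC(`p`) is at most `2 ^ (-n E(R) + o(n))`; by the above it concerns all four systems
    (∀ (n k m : ℕ → ℕ) (c : ∀ j, LinCode (n j) (k j) (m j)) (dec : ∀ j, Bits (m j) → Bits (n j))
        (ε : ℕ → ℝ), Filter.Tendsto n Filter.atTop Filter.atTop →
      ε =o[Filter.atTop] (fun j => (n j : ℝ)) → (∀ j, (c j).IsDecoder (dec j)) →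
      (∀ j, (c j).errorProb (dec j) (bscComp p₁ α) ≤
        two_pow (-((n j : EReal) * errorExponent (bscComp p₁ α) ((k j : ℝ) / n j)) + (ε j : EReal))) →
      ∀ j, ((c j).sketchKeyless (dec j) τ).PFR p₁ α ≤
        two_pow (-((n j : EReal) * klBits τ (bscComp p₁ α))) +
        two_pow (-((n j : EReal) * errorExponent (bscComp p₁ α) ((k j : ℝ) / n j)) +
          (ε j : EReal))) ∧
    -- codes as in (i) exist for all lengths and dimensions, with a common `o(n)` term
    (∃ ε : ℕ → ℝ, ε =o[Filter.atTop] (fun n : ℕ => (n : ℝ)) ∧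
      ∀ n k m : ℕ, k + m = n → ∃ c : LinCode n k m, (∃ dec, c.IsDecoder dec) ∧
        ∀ dec, c.IsDecoder dec →
          c.errorProb dec (bscComp p₁ α) ≤
            two_pow (-((n : EReal) * errorExponent (bscComp p₁ α) ((k : ℝ) / n)) +
              (ε n : EReal))) := by
  obtain ⟨hcode, hPFR, hexists⟩ := theorem1_general p₁ α τ hpτ.le hτ.le
  exact ⟨hcode, fun n k m c dec ε _ _ hdec _ j => (hPFR _ _ _ _ _ (hdec j)).trans le_self_add,
    hexists⟩
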